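/- Let $G$ be a finite connected (simple, undirected) graph and let $D_G$ be its symmetric digraph, whose arcs are the pairs $(u,v)$ and $(v,u)$ for the edges $uv$ of $G$. For an arc $e=(u,v)$ put $o(e)=u$, $t(e)=v$, $e^{-1}=(v,u)$. A cycle of $G$ is a sequence $C=(e_1,\dots,e_n)$, $n\ge 1$, of arcs with $t(e_i)=o(e_{i+1})$ for $1\le i<n$ and $t(e_n)=o(e_1)$; $|C|=n$. It is reduced if neither $C$ nor $C^2$ contains consecutive arcs $e,f$ with $f^{-1}=e$. An alternating cycle of $D_G$ is a sequence $C=[e_1,\dots,e_r]$, $r\ge1$, of arcs for which there are vertices $v_0,v_1,\dots,v_r=v_0$ such that either $e_1=(v_0,v_1),\ e_2=(v_2,v_1),\ e_3=(v_2,v_3),\dots$ or $e_1=(v_1,v_0),\ e_2=(v_1,v_2),\ e_3=(v_3,v_2),\dots$, and such that $o(e_1)=o(e_r)=v_0$ or $t(e_1)=t(e_r)=v_0$; $|C|=r$. It is reduced if $e_{i+1}\ne e_i$ for $1\le i<r$ and $e_r\neq e_1$. In both settings a cycle is prime if it is not a multiple $B^k$ of a strictly shorter cycle $B$ of the same kind,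 and two cycles are equivalent if they differ by a cyclic rotation. Put $$Z(G,t)=\prod_{[C]}\bigl(1-t^{|C|}\bigr)^{-1},\qquad Z_a(G,t)=\prod_{[C]}\bigl(1-t^{|C|}\bigr)^{-1},$$ where $[C]$ runs over the equivalence classes of prime, reduced cycles of $G$ in the first product (the Ihara zeta function of $G$), and over the equivalence classes of prime, reduced alternating cycles of $D_G$ in the second (the alternating zeta function of $G$). Then $$Z_a(G,t)=Z(G,t)\,Z(G,-t).$$ This holds as an identity of formal power series in $\mathbb Z[[t]]$, in which both Euler products converge. It also holds at every $t\in\mathbb C$ with $\sum_{[C]}|t|^{|C|}<\infty$ and $t^{|C|}\neq1\neq(-t)^{|C|}$ for all $[C]$ (sum and condition over the classes of prime, reduced cycles of $G$), and at such $t$ the Euler products of $Z(G,t)$, $Z(G,-t)$ and $Z_a(G,t)$ all converge unconditionally; moreover there is $r>0$ such that the sum is finite for all $t\in\mathbb C$ with $|t|<r$. -/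

import Mathlib

open scoped PowerSeries PowerSeries.WithPiTopology

namespace AltZeta

/-! ### Cyclic sequences and Euler products -/

/-- The sequence obtained by going `r` times around `B`. -/
def multiple {α : Type*} (B : List α) (r : ℕ) : List α :=
  (List.replicate r B).flatten

/-- The factor `(1 - X ^ |C|)⁻¹` as a formal power series. (The power series `1 - X ^ n` is a unit
for `n ≥ 1`, and its `Ring.inverse` is then its inverse.) -/
noncomputable def formalFactor {α : Type*} (C : Cycle α) : ℤ⟦X⟧ :=
  Ring.inverse (1 - PowerSeries.X ^ C.length)

/-- The factor `(1 - t ^ |C|)⁻¹` at a complex number `t`. -/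
noncomputable def factor {α : Type*} (t : ℂ) (C : Cycle α) : ℂ :=
  (1 - t ^ C.length)⁻¹

/-! ### Cycles of a graph and the Ihara zeta function

The arcs of the symmetric digraph of `G` are the darts of `G`; the origin, the terminus and the
inverse of the arc `e` are `e.fst`, `e.snd` and `e.symm`. -/

section Graph

variable {V : Type*} {G : SimpleGraph V}

/-- A path `(e₁, …, eₙ)`, `n ≥ 1`: the terminus of each arc is the origin of the next one. -/
def IsPath (P : List G.Dart) : Prop :=
  P ≠ [] ∧ P.IsChain fun e f => e.snd = f.fst

/-- `eᵢ₊₁⁻¹ = eᵢ` for some `i`. -/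
def HasBacktracking (P : List G.Dart) : Prop :=
  ∃ (i : ℕ) (h : i + 1 < P.length), P[i + 1].symm = P[i]

/-- A cycle is a path that ends where it starts. -/
def IsCycle (C : List G.Dart) : Prop :=
  IsPath C ∧ ∃ h : C ≠ [], (C.head h).fst = (C.getLast h).snd

/-- Neither `C` nor `C²` has a backtracking. -/
def IsReduced (C : List G.Dart) : Prop :=
  ¬ HasBacktracking C ∧ ¬ HasBacktracking (multiple C 2)

/-- `C` is not a multiple of a strictly smaller cycle. -/
def IsPrime (C : List G.Dart) : Prop :=
  ¬ ∃ (B : List G.Dart) (r : ℕ), IsCycle B ∧ B.length < C.length ∧ C = multiple B r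

/-- The equivalence classes, up to cyclic rotation, of prime, reduced cycles of `G`. -/
def primeClasses (G : SimpleGraph V) : Set (Cycle G.Dart) :=
  {c | ∃ C : List G.Dart, IsCycle C ∧ IsReduced C ∧ IsPrime C ∧ c = (C : Cycle G.Dart)}

/-- The Ihara zeta function of `G` as a formal power series. -/
noncomputable def iharaZetaFormal (G : SimpleGraph V) : ℤ⟦X⟧ :=
  ∏' c : primeClasses G, formalFactor c.1

/-- The Ihara zeta function of `G` at a complex number `t`. -/
noncomputable def iharaZeta (G : SimpleGraph V) (t : ℂ) : ℂ :=
  ∏' c : primeClasses G, factor t c.1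

end Graph

/-! ### Alternating cycles of a digraph and the alternating zeta function -/

section Digraph

variable {V : Type*} {D : Digraph V}

/-- The arcs of a digraph. -/
def Arc (D : Digraph V) : Type _ := {p : V × V // D.Adj p.1 p.2}

/-- The origin of an arc. -/
def Arc.o (e : Arc D) : V := e.1.1

/-- The terminus of an arc. -/
def Arc.t (e : Arc D) : V := e.1.2

/-- `P = (v₀, v₁, …, vᵣ) = [e₁, …, eᵣ]` is an alternating walk starting with an out-edge:
`e₁ = (v₀, v₁)`, `e₂ = (v₂, v₁)`, `e₃ = (v₂, v₃)`, … (the list `P` is indexed from `0`). -/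
def IsAltWalkOut (v : ℕ → V) (P : List (Arc D)) : Prop :=
  ∀ (i : ℕ) (h : i < P.length),
    (Even i → P[i].o = v i ∧ P[i].t = v (i + 1)) ∧
    (Odd i → P[i].o = v (i + 1) ∧ P[i].t = v i)

/-- `P = (v₀, v₁, …, vᵣ) = [e₁, …, eᵣ]` is an alternating walk starting with an in-edge:
`e₁ = (v₁, v₀)`, `e₂ = (v₁, v₂)`, `e₃ = (v₃, v₂)`, … -/
def IsAltWalkIn (v : ℕ → V) (P : List (Arc D)) : Prop :=
  ∀ (i : ℕ) (h : i < P.length),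
    (Even i → P[i].o = v (i + 1) ∧ P[i].t = v i) ∧
    (Odd i → P[i].o = v i ∧ P[i].t = v (i + 1))

/-- An alternating cycle: an alternating walk of positive length with `v₀ = vᵣ =: v` such that
`o(e₁) = o(eᵣ) = v` or `t(e₁) = t(eᵣ) = v`. -/
def IsAltCycle (C : List (Arc D)) : Prop :=
  ∃ (h : C ≠ []) (v : ℕ → V), (IsAltWalkOut v C ∨ IsAltWalkIn v C) ∧ v 0 = v C.length ∧
    (((C.head h).o = v 0 ∧ (C.getLast h).o = v 0) ∨
      ((C.head h).t = v 0 ∧ (C.getLast h).t = v 0))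

/-- `eᵢ₊₁ = eᵢ` for some `i`. -/
def HasAltBacktracking (P : List (Arc D)) : Prop :=
  ∃ (i : ℕ) (h : i + 1 < P.length), P[i + 1] = P[i]

/-- `eᵣ = e₁`. -/
def HasTail (C : List (Arc D)) : Prop :=
  ∃ h : C ≠ [], C.getLast h = C.head h

/-- Neither a backtracking nor a tail. -/
def IsAltReduced (C : List (Arc D)) : Prop :=
  ¬ HasAltBacktracking C ∧ ¬ HasTail C

/-- `C` is not a multiple of a strictly smaller alternating cycle. -/
def IsAltPrime (C : List (Arc D)) : Prop :=
  ¬ ∃ (B : List (Arc D)) (r : ℕ), IsAltCycle B ∧ B.length < C.length ∧ C = multiple B r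

/-- The equivalence classes, up to cyclic rotation, of prime, reduced alternating cycles of `D`. -/
def altPrimeClasses (D : Digraph V) : Set (Cycle (Arc D)) :=
  {c | ∃ C : List (Arc D),
    IsAltCycle C ∧ IsAltReduced C ∧ IsAltPrime C ∧ c = (C : Cycle (Arc D))}

/-- The alternating zeta function of a digraph as a formal power series. -/
noncomputable def altZetaFormal (D : Digraph V) : ℤ⟦X⟧ :=
  ∏' c : altPrimeClasses D, formalFactor c.1

/-- The alternating zeta function of a digraph at a complex number `t`. -/
noncomputable def altZeta (D : Digraph V) (t : ℂ) : ℂ :=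
  ∏' c : altPrimeClasses D, factor t c.1

/-- The symmetric digraph `D_G` of a graph `G`: each edge `uv` gives the arcs `(u,v)`, `(v,u)`. -/
def symmDigraph (G : SimpleGraph V) : Digraph V where
  Adj := G.Adj

end Digraph

end AltZeta

/-! Inverting every other arc of a walk without backtracking gives an alternating walk in which
consecutive arcs differ, and every such alternating walk arises this way. Prime reduced cycles of
either kind, up to rotation, are shift orbits of periodic infinite walks of that kind, with the
minimal period as length (`primeClasses_eq`, `altPrimeClasses_eq`). A walk has two alternating
versions, according to the parity of the inverted indices; each has minimal period `lcm n 2` if the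
walk has minimal period `n` (`minimalPeriod_alternate`). Shifting by an odd `n` exchanges the two
versions, while for even `n` they lie in different orbits. So a class of odd length `n` yields one
alternating class of length `2n`, and a class of even length yields two of length `n`
(`exists_equiv_altPrimeClasses`). The Euler factors then agree class by class: `1 - t^(2n) = (1 -
t^n)(1 - (-t)^n)` for odd `n`, and `(-t)^n = t^n` for even `n`. The convergence lemmas allow the
infinite products to be regrouped accordingly. -/

namespace AltZeta

open Function Filter

/-! ### Periodic sequences and cyclic words -/

section Sequences

variable {α : Type*}

/-- The shift of a sequence. -/
def shift (f : ℕ → α) : ℕ → α := fun i => f (i + 1)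

theorem iterate_shift_apply (k : ℕ) (f : ℕ → α) (i : ℕ) : (shift^[k] f) i = f (i + k) := by
  induction k generalizing f with
  | zero => rfl
  | succ k ih => rw [iterate_succ_apply, ih]; simp only [shift]; congr 1

theorem isPeriodicPt_shift_iff {n : ℕ} {f : ℕ → α} :
    IsPeriodicPt shift n f ↔ ∀ i, f (i + n) = f i := by
  simp only [IsPeriodicPt, IsFixedPt, funext_iff, iterate_shift_apply]

theorem apply_mod_of_isPeriodicPt {n : ℕ} {f : ℕ → α} (h : IsPeriodicPt shift n f) (i : ℕ) :
    f (i % n) = f i := by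
  have := isPeriodicPt_shift_iff.1 (h.const_mul (i / n)) (i % n)
  rwa [Nat.mod_add_div', eq_comm] at this

theorem apply_mod_add_one_of_isPeriodicPt {n : ℕ} {f : ℕ → α} (h : IsPeriodicPt shift n f)
    (i : ℕ) : f (i % n + 1) = f (i + 1) := by
  rw [← apply_mod_of_isPeriodicPt h, Nat.mod_add_mod, apply_mod_of_isPeriodicPt h]

/-- The first `n` terms of a sequence. -/
def word (f : ℕ → α) (n : ℕ) : List α := (List.range n).map f

@[simp] theorem length_word (f : ℕ → α) (n : ℕ) : (word f n).length = n := by simp [word]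

@[simp] theorem getElem_word (f : ℕ → α) (n i : ℕ) (h : i < (word f n).length) :
    (word f n)[i] = f i := by simp [word]

theorem word_ne_nil {f : ℕ → α} {n : ℕ} (h : 0 < n) : word f n ≠ [] := by
  rw [← List.length_pos_iff]; simpa

theorem head_word {f : ℕ → α} {n : ℕ} (h : word f n ≠ []) : (word f n).head h = f 0 := by
  simp [List.head_eq_getElem]

theorem getLast_word {f : ℕ → α} {n : ℕ} (h : word f n ≠ []) :
    (word f n).getLast h = f (n - 1) := by
  simp [List.getLast_eq_getElem]

theorem eq_of_word_eq {f g : ℕ → α} {n : ℕ} (hn : 0 < n) (hf : IsPeriodicPt shift n f)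
    (hg : IsPeriodicPt shift n g) (h : word f n = word g n) : f = g := by
  funext i
  rw [← apply_mod_of_isPeriodicPt hf, ← apply_mod_of_isPeriodicPt hg]
  have hi : i % n < (word f n).length := by simpa using Nat.mod_lt i hn
  simpa using List.getElem_of_eq h hi

/-- Every nonempty list consists of one period of a periodic sequence. -/
theorem exists_eq_word {C : List α} (hC : C ≠ []) :
    ∃ f, IsPeriodicPt shift C.length f ∧ C = word f C.length := by
  have hn := List.length_pos_iff.2 hC
  refine ⟨fun i => C[i % C.length]'(Nat.mod_lt _ hn), isPeriodicPt_shift_iff.2 (by simp), ?_⟩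
  refine List.ext_getElem (by simp) fun i h₁ h₂ => ?_
  simp [Nat.mod_eq_of_lt h₁]

theorem multiple_word {f : ℕ → α} {m : ℕ} (h : IsPeriodicPt shift m f) (r : ℕ) :
    multiple (word f m) r = word f (r * m) := by
  induction r with
  | zero => simp [multiple, word]
  | succ r ih =>
    have : multiple (word f m) (r + 1) = word f m ++ multiple (word f m) r := by
      simp [multiple, List.replicate_succ]
    rw [this, ih]
    refine List.ext_getElem (by simp; ring) fun i h₁ h₂ => ?_
    rw [List.getElem_append]
    split_ifs with hi
    · simp
    · simp only [length_word, not_lt] at hi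
      simp only [getElem_word, length_word]
      conv_rhs => rw [← Nat.sub_add_cancel hi, isPeriodicPt_shift_iff.1 h]

theorem rotate_word {f : ℕ → α} {n : ℕ} (h : IsPeriodicPt shift n f) (k : ℕ) :
    (word f n).rotate k = word (shift^[k] f) n := by
  refine List.ext_getElem (by simp) fun i h₁ h₂ => ?_
  simp [List.getElem_rotate, iterate_shift_apply, apply_mod_of_isPeriodicPt h]

/-- For a family `Q` of nonempty lists containing the minimal period of `f`, a period of `f` is not
a multiple of a shorter member of `Q` if and only if it is the minimal period of `f`. -/
theorem not_exists_multiple_iff {Q : List α → Prop} (hQ : ∀ B, Q B → B ≠ []) {f : ℕ → α} {n : ℕ}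
    (hn : 0 < n) (hf : IsPeriodicPt shift n f) (hm : Q (word f (minimalPeriod shift f))) :
    (¬ ∃ (B : List α) (r : ℕ), Q B ∧ B.length < (word f n).length ∧ word f n = multiple B r) ↔
      minimalPeriod shift f = n := by
  constructor
  · intro h
    by_contra hne
    refine h ⟨word f (minimalPeriod shift f), n / minimalPeriod shift f, hm, ?_, ?_⟩
    · simpa using lt_of_le_of_ne (hf.minimalPeriod_le hn) hne
    · rw [multiple_word (isPeriodicPt_minimalPeriod _ _), Nat.div_mul_cancel hf.minimalPeriod_dvd]
  · rintro h ⟨B, r, hB, hlt, heq⟩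
    -- The periodic extension of `B` agrees with `f` on a common period, hence everywhere; so
    -- `B.length` is a period of `f`, too short to lie below the minimal one.
    obtain ⟨g, hg, hBg⟩ := exists_eq_word (hQ B hB)
    rw [hBg, multiple_word hg] at heq
    have hlen : n = r * B.length := by simpa using congrArg List.length heq
    rw [← hlen] at heq
    have hgn : IsPeriodicPt shift n g := hlen ▸ hg.const_mul r
    have hfg := eq_of_word_eq hn hf hgn heq
    subst hfg
    have := hg.minimalPeriod_le (List.length_pos_iff.2 (hQ B hB))
    simp only [length_word] at hlt
    omega

/-- The cyclic word of a periodic sequence, of length its minimal period. -/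
noncomputable def cyclicWord (f : ℕ → α) : Cycle α := (word f (minimalPeriod shift f) : Cycle α)

@[simp] theorem length_cyclicWord (f : ℕ → α) :
    (cyclicWord f).length = minimalPeriod shift f := by
  simp [cyclicWord]

theorem cyclicWord_iterate_shift {f : ℕ → α} (hf : f ∈ periodicPts shift) (k : ℕ) :
    cyclicWord (shift^[k] f) = cyclicWord f := by
  rw [cyclicWord, minimalPeriod_apply_iterate hf, cyclicWord,
    ← rotate_word (isPeriodicPt_minimalPeriod _ _), Cycle.coe_eq_coe]
  exact List.IsRotated.symm ⟨k, rfl⟩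

/-- With `cyclicWord_iterate_shift`, this identifies cyclic words with shift orbits of periodic
sequences. -/
theorem exists_iterate_shift_eq {f g : ℕ → α} (hf : f ∈ periodicPts shift)
    (h : cyclicWord f = cyclicWord g) : ∃ k, shift^[k] f = g := by
  have hlen : minimalPeriod shift f = minimalPeriod shift g := by
    simpa using congrArg Cycle.length h
  rw [cyclicWord, cyclicWord, Cycle.coe_eq_coe] at h
  obtain ⟨k, hk⟩ := h
  rw [rotate_word (isPeriodicPt_minimalPeriod _ _), ← hlen] at hk
  refine ⟨k, eq_of_word_eq (minimalPeriod_pos_of_mem_periodicPts hf)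
    ((isPeriodicPt_minimalPeriod _ _).apply_iterate k) ?_ hk⟩
  rw [hlen]; exact isPeriodicPt_minimalPeriod _ _

/-- The cyclic words of the periodic sequences in a set. -/
def cyclicWords (X : Set (ℕ → α)) : Set (Cycle α) :=
  cyclicWord '' (X ∩ periodicPts shift)

theorem length_pos_of_mem_cyclicWords {X : Set (ℕ → α)} {c : Cycle α} (hc : c ∈ cyclicWords X) :
    0 < c.length := by
  obtain ⟨f, ⟨-, hf⟩, rfl⟩ := hc
  simpa using minimalPeriod_pos_of_mem_periodicPts hf

end Sequences

/-! ### Prime reduced cycles as periodic sequences -/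

section Graph

variable {V : Type*} {G : SimpleGraph V}

/-- The infinite walks without backtracking. -/
def nonBacktracking (G : SimpleGraph V) : Set (ℕ → G.Dart) :=
  {f | ∀ i, (f i).snd = (f (i + 1)).fst ∧ (f (i + 1)).symm ≠ f i}

theorem isCycle_word_iff {f : ℕ → G.Dart} {n : ℕ} (hn : 0 < n) (hf : IsPeriodicPt shift n f) :
    IsCycle (word f n) ↔ ∀ i, (f i).snd = (f (i + 1)).fst := by
  have hne : word f n ≠ [] := word_ne_nil hn
  simp only [IsCycle, IsPath, List.isChain_iff_getElem, head_word, getLast_word, length_word,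
    getElem_word]
  have h0 : f n = f 0 := by simpa using isPeriodicPt_shift_iff.1 hf 0
  constructor
  · rintro ⟨⟨-, h⟩, -, hc⟩ i
    rw [← apply_mod_of_isPeriodicPt hf i, ← apply_mod_add_one_of_isPeriodicPt hf i]
    have hi := Nat.mod_lt i hn
    by_cases h1 : i % n + 1 < n
    · exact h _ h1
    · have h2 : i % n + 1 = n := by omega
      rw [h2, h0, hc, show i % n = n - 1 by omega]
  · intro h
    refine ⟨⟨hne, fun i _ => h i⟩, hne, ?_⟩
    rw [h, Nat.sub_add_cancel hn, h0]

theorem isReduced_word_iff {f : ℕ → G.Dart} {n : ℕ} (hn : 0 < n) (hf : IsPeriodicPt shift n f) :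
    IsReduced (word f n) ↔ ∀ i, (f (i + 1)).symm ≠ f i := by
  rw [IsReduced, multiple_word hf]
  simp only [HasBacktracking, length_word, getElem_word]
  constructor
  · rintro ⟨-, h⟩ i hi
    -- The square of the cycle also contains the pair formed by the last and the first arc, so every
    -- residue `i % n` is covered.
    refine h ⟨i % n, by have := Nat.mod_lt i hn; omega, ?_⟩
    rw [apply_mod_of_isPeriodicPt hf, ← hi, ← apply_mod_add_one_of_isPeriodicPt hf i]
  · exact fun h => ⟨fun ⟨i, _, hi⟩ => h i hi, fun ⟨i, _, hi⟩ => h i hi⟩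

theorem primeClasses_eq : primeClasses G = cyclicWords (nonBacktracking G) := by
  ext c
  have key : ∀ {f : ℕ → G.Dart} {n : ℕ}, 0 < n → IsPeriodicPt shift n f →
      IsCycle (word f n) → (IsPrime (word f n) ↔ minimalPeriod shift f = n) := by
    intro f n hn hf hc
    refine not_exists_multiple_iff (fun B hB => hB.1.1) hn hf ?_
    rw [isCycle_word_iff (hf.minimalPeriod_pos hn) (isPeriodicPt_minimalPeriod _ _)]
    rwa [isCycle_word_iff hn hf] at hc
  constructor
  · rintro ⟨C, hc, hr, hp, rfl⟩
    obtain ⟨f, hf, hC⟩ := exists_eq_word hc.1.1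
    have hn := List.length_pos_iff.2 hc.1.1
    generalize C.length = n at *
    subst hC
    rw [key hn hf hc] at hp
    rw [isCycle_word_iff hn hf] at hc
    rw [isReduced_word_iff hn hf] at hr
    exact ⟨f, ⟨fun i => ⟨hc i, hr i⟩, n, hn, hf⟩, by rw [cyclicWord, hp]⟩
  · rintro ⟨f, ⟨hX, hf⟩, rfl⟩
    have hn := minimalPeriod_pos_of_mem_periodicPts hf
    have hp := isPeriodicPt_minimalPeriod shift f
    have hc := (isCycle_word_iff hn hp).2 fun i => (hX i).1
    exact ⟨_, hc, (isReduced_word_iff hn hp).2 fun i => (hX i).2, (key hn hp hc).2 rfl, rfl⟩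

end Graph

/-! ### Prime reduced alternating cycles as periodic sequences -/

section Alternating

/-- Consecutive terms of `f` share, in turns, their image under `t` and their image under `o`. -/
def Alternates {α V : Type*} (o t : α → V) (f : ℕ → α) : Prop :=
  ∀ i, (Even i → t (f i) = t (f (i + 1))) ∧ (Odd i → o (f i) = o (f (i + 1)))

/-- The closing condition forces even length: in odd length the last arc would have `t` equal to `v
n = v 0`, hence equal to its own `o`. Keeping `o` and `t` abstract lets one proof serve walks
starting with an out-edge and, after a swap, with an in-edge. -/
theorem even_and_alternates_of_walk {α V : Type*} {o t : α → V} (hot : ∀ a, o a ≠ t a)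
    {f : ℕ → α} {n : ℕ} (hn : 0 < n) (hf : IsPeriodicPt shift n f) {v : ℕ → V}
    (hv : ∀ i < n, (Even i → o (f i) = v i ∧ t (f i) = v (i + 1)) ∧
      (Odd i → o (f i) = v (i + 1) ∧ t (f i) = v i)) (h0 : v 0 = v n)
    (hc : (o (f 0) = v 0 ∧ o (f (n - 1)) = v 0) ∨ (t (f 0) = v 0 ∧ t (f (n - 1)) = v 0)) :
    Even n ∧ Alternates o t f := by
  have hfirst := (hv 0 hn).1 (by simp)
  have hn1 : n - 1 + 1 = n := by omega
  have hE : Even n := by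
    rcases hc with ⟨-, hc⟩ | ⟨hc, -⟩
    · by_contra hE
      have hlast := (hv (n - 1) (by omega)).1 (by rw [Nat.not_even_iff_odd] at hE; grind)
      rw [hn1, ← h0] at hlast
      exact hot _ (hc.trans hlast.2.symm)
    · exact absurd (hfirst.1.trans hc.symm) (hot _)
  refine ⟨hE, fun i => ?_⟩
  -- Since `n` is even, reduction modulo `n` preserves parity, and it suffices to check one period.
  have hpar : Even (i % n) ↔ Even i := by
    rw [Nat.even_iff, Nat.even_iff, Nat.mod_mod_of_dvd _ hE.two_dvd]
  have hi := Nat.mod_lt i hn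
  rw [← apply_mod_of_isPeriodicPt hf i, ← apply_mod_add_one_of_isPeriodicPt hf i,
    ← hpar, ← Nat.not_even_iff_odd, ← hpar, Nat.not_even_iff_odd]
  generalize i % n = j at hi
  by_cases h1 : j + 1 < n
  · refine ⟨fun hj => ?_, fun hj => ?_⟩
    · rw [((hv j hi).1 hj).2, ((hv (j + 1) h1).2 hj.add_one).2]
    · rw [((hv j hi).2 hj).1, ((hv (j + 1) h1).1 hj.add_one).1]
  · obtain rfl : j + 1 = n := by omega
    have : f (j + 1) = f 0 := by simpa using isPeriodicPt_shift_iff.1 hf 0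
    refine ⟨fun hj => absurd hE (by simpa using hj.add_one), fun hj => ?_⟩
    rw [((hv j hi).2 hj).1, this, hfirst.1, h0]

theorem exists_walk_of_alternates {α V : Type*} {o t : α → V} {f : ℕ → α} {n : ℕ} (hn : 0 < n)
    (hf : IsPeriodicPt shift n f) (hE : Even n) (hA : Alternates o t f) :
    ∃ v : ℕ → V, (∀ i, (Even i → o (f i) = v i ∧ t (f i) = v (i + 1)) ∧
      (Odd i → o (f i) = v (i + 1) ∧ t (f i) = v i)) ∧ v 0 = v n ∧
      o (f 0) = v 0 ∧ o (f (n - 1)) = v 0 := by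
  have h0 : f n = f 0 := by simpa using isPeriodicPt_shift_iff.1 hf 0
  refine ⟨fun i => if Even i then o (f i) else t (f i), fun i => ⟨fun hi => ?_, fun hi => ?_⟩,
    ?_, ?_, ?_⟩
  · simpa [hi, Nat.even_add_one] using (hA i).1 hi
  · have hi' := Nat.not_even_iff_odd.2 hi
    simpa [hi', Nat.even_add_one] using (hA i).2 hi
  · simp [hE, h0]
  · simp
  · rw [(hA (n - 1)).2 (by grind), Nat.sub_add_cancel hn, h0]
    simp

variable {V : Type*} {G : SimpleGraph V}

theorem Arc.o_ne_t (e : Arc (symmDigraph G)) : e.o ≠ e.t := G.ne_of_adj e.2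

theorem Arc.ext_o_t {D : Digraph V} {e f : Arc D} (ho : e.o = f.o) (ht : e.t = f.t) : e = f :=
  Subtype.ext (Prod.ext ho ht)

theorem isAltCycle_word_iff {f : ℕ → Arc (symmDigraph G)} {n : ℕ} (hn : 0 < n)
    (hf : IsPeriodicPt shift n f) :
    IsAltCycle (word f n) ↔
      Even n ∧ (Alternates Arc.o Arc.t f ∨ Alternates Arc.t Arc.o f) := by
  have hne : word f n ≠ [] := word_ne_nil hn
  simp only [IsAltCycle, IsAltWalkOut, IsAltWalkIn, head_word, getLast_word, length_word,
    getElem_word]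
  constructor
  · rintro ⟨-, v, hv | hv, h0, hc⟩
    · have := even_and_alternates_of_walk Arc.o_ne_t hn hf hv h0 hc
      exact ⟨this.1, .inl this.2⟩
    · have := even_and_alternates_of_walk (o := Arc.t) (t := Arc.o) (fun a => a.o_ne_t.symm) hn hf
        (fun i hi => ⟨fun h => ((hv i hi).1 h).symm, fun h => ((hv i hi).2 h).symm⟩) h0 hc.symm
      exact ⟨this.1, .inr this.2⟩
  · rintro ⟨hE, hA | hA⟩
    · obtain ⟨v, hv, h0, hc⟩ := exists_walk_of_alternates hn hf hE hA
      exact ⟨hne, v, .inl fun i _ => hv i, h0, .inl hc⟩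
    · obtain ⟨v, hv, h0, hc⟩ := exists_walk_of_alternates hn hf hE hA
      exact ⟨hne, v, .inr fun i _ => ⟨fun h => ((hv i).1 h).symm, fun h => ((hv i).2 h).symm⟩,
        h0, .inr hc⟩

theorem isAltReduced_word_iff {D : Digraph V} {f : ℕ → Arc D} {n : ℕ} (hn : 0 < n)
    (hf : IsPeriodicPt shift n f) : IsAltReduced (word f n) ↔ ∀ i, f (i + 1) ≠ f i := by
  have hne : word f n ≠ [] := word_ne_nil hn
  have h0 : f n = f 0 := by simpa using isPeriodicPt_shift_iff.1 hf 0
  simp only [IsAltReduced, HasAltBacktracking, HasTail, length_word, getElem_word, head_word,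
    getLast_word]
  constructor
  · rintro ⟨h, ht⟩ i hi
    rw [← apply_mod_of_isPeriodicPt hf i, ← apply_mod_add_one_of_isPeriodicPt hf i] at hi
    have hlt := Nat.mod_lt i hn
    by_cases h1 : i % n + 1 < n
    · exact h ⟨_, h1, hi⟩
    · have h2 : i % n + 1 = n := by omega
      rw [h2, h0] at hi
      refine ht ⟨hne, ?_⟩
      rw [hi]
      congr 1
      omega
  · refine fun h => ⟨fun ⟨i, _, hi⟩ => h i hi, fun ⟨_, ht⟩ => h (n - 1) ?_⟩
    rw [Nat.sub_add_cancel hn, h0, ht]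

/-- The infinite alternating walks without backtracking. -/
def altNonBacktracking (G : SimpleGraph V) : Set (ℕ → Arc (symmDigraph G)) :=
  {f | (Alternates Arc.o Arc.t f ∨ Alternates Arc.t Arc.o f) ∧ ∀ i, f (i + 1) ≠ f i}

/-- If `n` were odd, the arcs at `0` and `1` would share `t` by alternation at index `0`, and `o` by
alternation at index `n`, so they would coincide. -/
theorem even_of_isPeriodicPt_of_alternates {α V : Type*} {o t : α → V}
    (hinj : ∀ a b, o a = o b → t a = t b → a = b) {f : ℕ → α} {n : ℕ}
    (hf : IsPeriodicPt shift n f) (hA : Alternates o t f) (hr : ∀ i, f (i + 1) ≠ f i) :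
    Even n := by
  by_contra hn
  rw [Nat.not_even_iff_odd] at hn
  have h0 : f n = f 0 := by simpa using isPeriodicPt_shift_iff.1 hf 0
  have h1 : f (n + 1) = f 1 := by simpa [add_comm] using isPeriodicPt_shift_iff.1 hf 1
  have ho := (hA n).2 hn
  rw [h0, h1] at ho
  exact hr 0 (hinj _ _ ho.symm ((hA 0).1 (by simp)).symm)

theorem even_of_mem_altNonBacktracking {f : ℕ → Arc (symmDigraph G)} {n : ℕ}
    (hf : IsPeriodicPt shift n f) (h : f ∈ altNonBacktracking G) : Even n := by
  obtain ⟨hA | hA, hr⟩ := h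
  · exact even_of_isPeriodicPt_of_alternates (fun _ _ => Arc.ext_o_t) hf hA hr
  · exact even_of_isPeriodicPt_of_alternates (fun _ _ ht ho => Arc.ext_o_t ho ht) hf hA hr

theorem altPrimeClasses_eq :
    altPrimeClasses (symmDigraph G) = cyclicWords (altNonBacktracking G) := by
  ext c
  have key : ∀ {f : ℕ → Arc (symmDigraph G)} {n : ℕ}, 0 < n → IsPeriodicPt shift n f →
      f ∈ altNonBacktracking G → (IsAltPrime (word f n) ↔ minimalPeriod shift f = n) := by
    intro f n hn hf hX
    refine not_exists_multiple_iff (fun B hB => hB.1) hn hf ?_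
    have hm := isPeriodicPt_minimalPeriod shift f
    rw [isAltCycle_word_iff (hf.minimalPeriod_pos hn) hm]
    -- The minimal period is even, so the primitive block is itself an alternating cycle; this makes
    -- primality equivalent to minimality of the period.
    exact ⟨even_of_mem_altNonBacktracking hm hX, hX.1⟩
  constructor
  · rintro ⟨C, hc, hr, hp, rfl⟩
    obtain ⟨f, hf, hC⟩ := exists_eq_word hc.1
    have hn := List.length_pos_iff.2 hc.1
    generalize C.length = n at *
    subst hC
    rw [isAltCycle_word_iff hn hf] at hc
    rw [isAltReduced_word_iff hn hf] at hr
    rw [key hn hf ⟨hc.2, hr⟩] at hp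
    exact ⟨f, ⟨⟨hc.2, hr⟩, n, hn, hf⟩, by rw [cyclicWord, hp]⟩
  · rintro ⟨f, ⟨hX, hf⟩, rfl⟩
    have hn := minimalPeriod_pos_of_mem_periodicPts hf
    have hp := isPeriodicPt_minimalPeriod shift f
    exact ⟨_, (isAltCycle_word_iff hn hp).2 ⟨even_of_mem_altNonBacktracking hp hX, hX.1⟩,
      (isAltReduced_word_iff hn hp).2 hX.2, (key hn hp hX).2 rfl, rfl⟩

end Alternating

/-! ### From walks to alternating walks -/

section Flip

variable {V : Type*} {G : SimpleGraph V}

/-- An arc of `G` as an arc of its symmetric digraph. -/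
def toArc (d : G.Dart) : Arc (symmDigraph G) := ⟨(d.fst, d.snd), d.adj⟩

theorem toArc_bijective : Bijective (toArc (G := G)) := by
  refine ⟨fun d d' h => ?_, fun e => ⟨⟨e.1, e.2⟩, rfl⟩⟩
  exact SimpleGraph.Dart.ext _ _ (congrArg Subtype.val h)

/-- The sequence obtained from a walk by inverting every other arc: the arcs of odd index if `b`
is even, and those of even index if `b` is odd. -/
def alternate (f : ℕ → G.Dart) (b : ℕ) : ℕ → Arc (symmDigraph G) :=
  fun i => toArc (if Even (i + b) then f i else (f i).symm)

theorem iterate_shift_alternate (f : ℕ → G.Dart) (b k : ℕ) :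
    shift^[k] (alternate f b) = alternate (shift^[k] f) (b + k) := by
  funext i
  simp only [iterate_shift_apply, alternate]
  rw [show i + k + b = i + (b + k) by ring]

theorem alternate_congr (f : ℕ → G.Dart) {b b' : ℕ} (h : Even b ↔ Even b') :
    alternate f b = alternate f b' := by
  funext i
  simp only [alternate, Nat.even_add, h]

/-- With opposite parities, `f'` would invert every arc of `f` in place; both being walks, the
second arc of `f` would then be the inverse of the first. -/
theorem alternate_eq_iff {f f' : ℕ → G.Dart} (hf : f ∈ nonBacktracking G)
    (hf' : f' ∈ nonBacktracking G) {b b' : ℕ} :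
    alternate f b = alternate f' b' ↔ f = f' ∧ (Even b ↔ Even b') := by
  refine ⟨fun h => ?_, fun ⟨h₁, h₂⟩ => h₁ ▸ alternate_congr f h₂⟩
  have h' : ∀ i, (if Even (i + b) then f i else (f i).symm) =
      if Even (i + b') then f' i else (f' i).symm :=
    fun i => toArc_bijective.1 (congrFun h i)
  by_cases hb : Even b ↔ Even b'
  · refine ⟨funext fun i => ?_, hb⟩
    have := h' i
    simp only [Nat.even_add, hb] at this
    split_ifs at this
    · exact this
    · exact SimpleGraph.Dart.symm_involutive.injective this
  · exfalso
    have hs : ∀ i, f' i = (f i).symm := by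
      intro i
      have := h' i
      have hi : Even (i + b') ↔ ¬ Even (i + b) := by
        simp only [Nat.even_add]; tauto
      by_cases hib : Even (i + b)
      · simp only [hi, hib, not_true_eq_false, if_true, if_false] at this
        rw [this, SimpleGraph.Dart.symm_symm]
      · simp only [hi, hib, not_false_eq_true, if_true, if_false] at this
        exact this.symm
    have h0 := (hf' 0).1
    rw [hs, hs] at h0
    refine (hf 0).2 (SimpleGraph.Dart.ext _ _ (Prod.ext h0.symm (hf 0).1.symm))

theorem isPeriodicPt_alternate_iff {f : ℕ → G.Dart} (hf : f ∈ nonBacktracking G) {b k : ℕ} :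
    IsPeriodicPt shift k (alternate f b) ↔ IsPeriodicPt shift k f ∧ Even k := by
  have hk : shift^[k] f ∈ nonBacktracking G := fun i => by
    simpa only [iterate_shift_apply, add_right_comm] using hf (i + k)
  rw [IsPeriodicPt, IsFixedPt, iterate_shift_alternate, alternate_eq_iff hk hf, Nat.even_add]
  simp only [IsPeriodicPt, IsFixedPt]
  tauto

theorem minimalPeriod_alternate {f : ℕ → G.Dart} (hf : f ∈ nonBacktracking G) (b : ℕ) :
    minimalPeriod shift (alternate f b) = (minimalPeriod shift f).lcm 2 :=
  eq_of_forall_dvd fun k => by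
    rw [← isPeriodicPt_iff_minimalPeriod_dvd, isPeriodicPt_alternate_iff hf,
      isPeriodicPt_iff_minimalPeriod_dvd, even_iff_two_dvd, Nat.lcm_dvd_iff]

theorem alternate_mem_periodicPts {f : ℕ → G.Dart} (hf : f ∈ nonBacktracking G)
    (hp : f ∈ periodicPts shift) (b : ℕ) : alternate f b ∈ periodicPts shift := by
  obtain ⟨n, hn, h⟩ := hp
  exact ⟨2 * n, by omega, (isPeriodicPt_alternate_iff hf).2 ⟨h.const_mul 2, even_two_mul n⟩⟩

theorem alternate_mem_altNonBacktracking {f : ℕ → G.Dart} (hf : f ∈ nonBacktracking G) (b : ℕ) :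
    alternate f b ∈ altNonBacktracking G := by
  constructor
  · by_cases hb : Even b
    · refine .inl fun i => ⟨fun hi => ?_, fun hi => ?_⟩
      · simpa [alternate, Nat.even_add, hi, hb, Arc.t, toArc] using (hf i).1
      · rw [← Nat.not_even_iff_odd] at hi
        simpa [alternate, Nat.even_add, hi, hb, Arc.o, toArc] using (hf i).1
    · refine .inr fun i => ⟨fun hi => ?_, fun hi => ?_⟩
      · simpa [alternate, Nat.even_add, hi, hb, Arc.o, toArc] using (hf i).1
      · rw [← Nat.not_even_iff_odd] at hi
        simpa [alternate, Nat.even_add, hi, hb, Arc.t, toArc] using (hf i).1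
  · intro i h
    have := toArc_bijective.1 h
    simp only [add_right_comm i 1 b, Nat.even_add_one] at this
    by_cases hi : Even (i + b)
    · exact (hf i).2 (by simpa [hi] using this)
    · refine (hf i).2 ?_
      simp only [hi, not_false_eq_true, if_true, if_false] at this
      rw [this, SimpleGraph.Dart.symm_symm]

/-- Inverting every other arc is an involution, so the preimage is obtained by the same operation;
`b` records which end the first two arcs share. -/
theorem exists_alternate_eq {g : ℕ → Arc (symmDigraph G)} (hg : g ∈ altNonBacktracking G) :
    ∃ f ∈ nonBacktracking G, ∃ b, alternate f b = g := by
  obtain ⟨d, hd⟩ : ∃ d : ℕ → G.Dart, ∀ i, toArc (d i) = g i :=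
    ⟨_, fun i => (toArc_bijective.2 (g i)).choose_spec⟩
  obtain ⟨b, hb⟩ : ∃ b : ℕ, ∀ i, (Even (i + b) → (g i).t = (g (i + 1)).t) ∧
      (¬ Even (i + b) → (g i).o = (g (i + 1)).o) := by
    rcases hg.1 with h | h
    · exact ⟨0, fun i => ⟨(h i).1, fun hi => (h i).2 (Nat.not_even_iff_odd.1 hi)⟩⟩
    · refine ⟨1, fun i => ?_⟩
      rw [Nat.even_add_one, not_not]
      exact ⟨fun hi => (h i).2 (Nat.not_even_iff_odd.1 hi), (h i).1⟩
  refine ⟨fun i => if Even (i + b) then d i else (d i).symm, fun i => ?_, b, funext fun i => ?_⟩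
  · have hr : d (i + 1) ≠ d i := fun h => hg.2 i (by rw [← hd, ← hd, h])
    have hb' := hb i
    rw [← hd, ← hd] at hb'
    simp only [add_right_comm i 1 b, Nat.even_add_one]
    by_cases hi : Even (i + b)
    · simpa [hi, hr, toArc, Arc.t] using hb'.1 hi
    · simp only [hi, not_false_eq_true, if_true, if_false]
      exact ⟨hb'.2 hi, fun h => hr (SimpleGraph.Dart.symm_involutive.injective h)⟩
  · rw [← hd]
    by_cases hi : Even (i + b) <;> simp [alternate, hi]

/-- The prime classes of alternating cycles: one for each prime class of cycles, and a second one
for each prime class of even length. -/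
theorem exists_equiv_altPrimeClasses (G : SimpleGraph V) :
    ∃ E : (primeClasses G ⊕ {c : primeClasses G | Even c.1.length}) ≃
        altPrimeClasses (symmDigraph G),
      (∀ c, (E (.inl c)).1.length = c.1.length.lcm 2) ∧
        ∀ c, (E (.inr c)).1.length = c.1.1.length := by
  rw [primeClasses_eq, altPrimeClasses_eq]
  choose F hF hFc using fun c : cyclicWords (nonBacktracking G) => c.2
  have hX := fun c => (hF c).1
  have hP := fun c => (hF c).2
  have hlen : ∀ c, minimalPeriod shift (F c) = c.1.length := fun c => by
    rw [← length_cyclicWord, hFc]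
  let A (c : cyclicWords (nonBacktracking G)) (b : ℕ) : cyclicWords (altNonBacktracking G) :=
    ⟨cyclicWord (alternate (F c) b), _,
      ⟨alternate_mem_altNonBacktracking (hX c) b, alternate_mem_periodicPts (hX c) (hP c) b⟩, rfl⟩
  have hA : ∀ c b, (A c b).1.length = c.1.length.lcm 2 := fun c b => by
    rw [length_cyclicWord, minimalPeriod_alternate (hX c), hlen]
  have hinj : ∀ c c' b b', A c b = A c' b' →
      c = c' ∧ (Even c.1.length → (Even b ↔ Even b')) := by
    intro c c' b b' h
    obtain ⟨k, hk⟩ := exists_iterate_shift_eq (alternate_mem_periodicPts (hX c) (hP c) b)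
      (congrArg Subtype.val h)
    have hXk : shift^[k] (F c) ∈ nonBacktracking G := fun i => by
      simpa only [iterate_shift_apply, add_right_comm] using hX c (i + k)
    rw [iterate_shift_alternate, alternate_eq_iff hXk (hX c')] at hk
    have hcc : c = c' := Subtype.ext <| by
      rw [← hFc, ← hFc c', ← hk.1, cyclicWord_iterate_shift (hP c)]
    subst hcc
    refine ⟨rfl, fun hE => ?_⟩
    -- The shift by `k` fixes `F c`, so `k` is a multiple of the length; an even length makes `k`
    -- even and the parity of `b` an invariant of the orbit.
    have hdvd : c.1.length ∣ k := by
      rw [← hlen, ← isPeriodicPt_iff_minimalPeriod_dvd]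
      exact hk.1
    have hkE : Even k := even_iff_two_dvd.2 (hE.two_dvd.trans hdvd)
    rw [← hk.2, Nat.even_add]
    tauto
  have hcongr : ∀ c b b', (Even b ↔ Even b') → A c b = A c b' := fun c b b' h =>
    Subtype.ext (congrArg cyclicWord (alternate_congr _ h))
  have hodd : ∀ c b, ¬ Even c.1.length → A c b = A c (b + 1) := by
    intro c b hc
    refine Subtype.ext ?_
    change cyclicWord (alternate (F c) b) = cyclicWord (alternate (F c) (b + 1))
    -- Shifting by the odd length fixes the walk but flips the parity, so both alternating versions
    -- lie in one orbit.
    rw [← cyclicWord_iterate_shift (alternate_mem_periodicPts (hX c) (hP c) b) c.1.length,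
      iterate_shift_alternate, ← hlen, isPeriodicPt_minimalPeriod shift (F c), hlen]
    congr 1
    apply alternate_congr
    simp only [Nat.even_add, hc, Nat.not_even_one]
  have hbij : Bijective (Sum.elim (fun c => A c 0)
      (fun c : {c : cyclicWords (nonBacktracking G) | Even c.1.length} => A c.1 1)) := by
    constructor
    · rintro (c | c) (c' | c') h
      · exact congrArg Sum.inl (hinj _ _ _ _ h).1
      · have := hinj _ _ _ _ h
        have hE : Even c.1.length := this.1 ▸ c'.2
        simpa using this.2 hE
      · have := hinj _ _ _ _ h
        simpa using this.2 c.2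
      · exact congrArg Sum.inr (Subtype.ext (hinj _ _ _ _ h).1)
    · intro a
      obtain ⟨g, ⟨hg, hgp⟩, hga⟩ := a.2
      obtain ⟨f, hf, b, rfl⟩ := exists_alternate_eq hg
      have hfp : f ∈ periodicPts shift := by
        obtain ⟨n, hn, h⟩ := hgp
        exact ⟨n, hn, ((isPeriodicPt_alternate_iff hf).1 h).1⟩
      obtain ⟨c, hc⟩ : ∃ c : cyclicWords (nonBacktracking G), c.1 = cyclicWord f :=
        ⟨⟨_, f, ⟨hf, hfp⟩, rfl⟩, rfl⟩
      obtain ⟨k, hk⟩ := exists_iterate_shift_eq hfp (hc.symm.trans (hFc c).symm)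
      have haA : A c (b + k) = a := Subtype.ext <| by
        change cyclicWord (alternate (F c) (b + k)) = _
        rw [← hk, ← iterate_shift_alternate, cyclicWord_iterate_shift hgp, hga]
      by_cases hbk : Even (b + k)
      · exact ⟨.inl c, (hcongr c _ _ (by simp [hbk])).trans haA⟩
      · by_cases hE : Even c.1.length
        · exact ⟨.inr ⟨c, hE⟩, (hcongr c _ _ (by simp [hbk])).trans haA⟩
        · rw [hodd c _ hE] at haA
          exact ⟨.inl c, (hcongr c _ _ (by simp [hbk, Nat.even_add_one])).trans haA⟩
  refine ⟨Equiv.ofBijective _ hbij, fun c => hA c 0, fun c => (hA c.1 1).trans ?_⟩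
  exact Nat.lcm_eq_left (even_iff_two_dvd.1 c.2)

end Flip

/-! ### Convergence of the Euler products -/

section Convergence

theorem finite_setOf_length_le {α : Type*} [Finite α] (n : ℕ) :
    {c : Cycle α | c.length ≤ n}.Finite := by
  refine ((List.finite_length_le α n).image (fun l : List α => (l : Cycle α))).subset fun c hc => ?_
  induction c using Quotient.inductionOn with
  | h l => exact ⟨l, hc, rfl⟩

theorem tendsto_length_cofinite {α : Type*} [Finite α] (S : Set (Cycle α)) :
    Tendsto (fun c : S => c.1.length) cofinite atTop := by
  refine tendsto_atTop.2 fun n => ?_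
  have h := (finite_setOf_length_le (α := α) n).preimage (f := ((↑) : S → Cycle α))
    Subtype.val_injective.injOn
  refine (h.subset ?_ : Set.Finite _)
  intro c hc
  exact (not_le.1 (show ¬ n ≤ c.1.length from hc)).le

/-- There are `(Nat.card α) ^ n` words of length `n`, so the sum is a geometric series. -/
theorem summable_pow_length {α : Type*} [Finite α] {x : ℝ} (hx : 0 ≤ x)
    (h : Nat.card α * x < 1) : Summable fun l : List α => x ^ l.length := by
  have := Fintype.ofFinite α
  rw [← List.equivSigmaTuple.symm.summable_iff]
  refine (summable_sigma_of_nonneg fun _ => pow_nonneg hx _).2 ⟨fun n => Summable.of_finite, ?_⟩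
  refine (summable_geometric_of_lt_one (by positivity) h).congr fun n => ?_
  simp [List.equivSigmaTuple, tsum_fintype, mul_pow]

theorem exists_summable_pow_length {α : Type*} [Finite α] (S : Set (Cycle α)) :
    ∃ r : ℝ, 0 < r ∧ ∀ t : ℂ, ‖t‖ < r → Summable fun c : S => ‖t‖ ^ c.1.length := by
  -- The `+ 1` keeps the radius positive when `α` is empty.
  refine ⟨((Nat.card α : ℝ) + 1)⁻¹, by positivity, fun t ht => ?_⟩
  have h : Nat.card α * ‖t‖ < 1 := by
    have := mul_lt_mul_of_pos_left ht (by positivity : (0 : ℝ) < Nat.card α + 1)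
    rw [mul_inv_cancel₀ (by positivity)] at this
    nlinarith [norm_nonneg t]
  have hinj : Injective fun c : S => (Quotient.out c.1 : List α) :=
    Quotient.out_injective.comp Subtype.val_injective
  refine ((summable_pow_length (norm_nonneg t) h).comp_injective hinj).congr fun c => ?_
  conv_rhs => rw [← Quotient.out_eq c.1]
  rfl

/-- Write the factor as `1 + a i / (1 - a i)`; for all but finitely many `i` the denominator has
norm at least `1/2`, so the fractions are absolutely summable. -/
theorem multipliable_inv_one_sub {ι : Type*} {a : ι → ℂ} (h : Summable fun i => ‖a i‖)
    (ha : ∀ i, a i ≠ 1) : Multipliable fun i => (1 - a i)⁻¹ := by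
  have hsum : Summable fun i => ‖a i / (1 - a i)‖ := by
    refine Summable.of_norm_bounded_eventually (h.mul_left 2) ?_
    have := h.tendsto_cofinite_zero.eventually (gt_mem_nhds (by norm_num : (0 : ℝ) < 1 / 2))
    filter_upwards [this] with i hi
    have h1 : 1 / 2 ≤ ‖1 - a i‖ := by
      have := norm_sub_norm_le 1 (a i)
      rw [norm_one] at this
      linarith
    rw [norm_norm, norm_div, div_le_iff₀ (by linarith)]
    nlinarith [norm_nonneg (a i)]
  refine (multipliable_one_add_of_summable hsum).congr fun i => ?_
  have : 1 - a i ≠ 0 := sub_ne_zero.2 (ha i).symm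
  field_simp
  ring

theorem isUnit_one_sub_X_pow {m : ℕ} (hm : 0 < m) :
    IsUnit (1 - PowerSeries.X ^ m : ℤ⟦X⟧) := by
  rw [PowerSeries.isUnit_iff_constantCoeff]
  simp [hm.ne']

theorem X_pow_dvd_inverse_one_sub_X_pow_sub_one {m : ℕ} (hm : 0 < m) :
    (PowerSeries.X ^ m : ℤ⟦X⟧) ∣ Ring.inverse (1 - PowerSeries.X ^ m) - 1 := by
  refine ⟨Ring.inverse (1 - PowerSeries.X ^ m), ?_⟩
  have := Ring.inverse_mul_cancel _ (isUnit_one_sub_X_pow hm)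
  linear_combination this

/-- Expand the product over finite sets `s`. The term of `s` is divisible by `X ^ m i` for each `i ∈
s`, so it affects the coefficient of `X ^ n` only if `s` lies in the finite set where `m i ≤ n`. -/
theorem multipliable_inverse_one_sub_X_pow {ι : Type*} {m : ι → ℕ} (hm : ∀ i, 0 < m i)
    (h : Tendsto m cofinite atTop) :
    Multipliable fun i => (Ring.inverse (1 - PowerSeries.X ^ m i) : ℤ⟦X⟧) := by
  have hs : Summable fun s : Finset ι =>
      ∏ i ∈ s, (Ring.inverse (1 - PowerSeries.X ^ m i) - 1 : ℤ⟦X⟧) := by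
    refine (PowerSeries.WithPiTopology.summable_iff_summable_coeff _).2 fun n =>
      summable_of_hasFiniteSupport ?_
    have hfin : {i | m i ≤ n}.Finite := by
      have := h.eventually_gt_atTop n
      simpa [Filter.Eventually, mem_cofinite, Set.compl_ofPred] using this
    refine hfin.toFinset.powerset.finite_toSet.subset fun s hs => ?_
    refine Finset.mem_coe.2 (Finset.mem_powerset.2 fun i hi => hfin.mem_toFinset.2 ?_)
    change m i ≤ n
    by_contra hn
    refine hs ?_
    have hd := (X_pow_dvd_inverse_one_sub_X_pow_sub_one (hm i)).trans
      (Finset.dvd_prod_of_mem (fun i => (Ring.inverse (1 - PowerSeries.X ^ m i) - 1 : ℤ⟦X⟧)) hi)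
    exact PowerSeries.X_pow_dvd_iff.1 hd n (not_le.1 hn)
  simpa using multipliable_one_add_of_summable_prod hs

/-- Continuity lets the substitution `X ↦ -X` pass through the infinite product. -/
theorem continuous_evalNegHom : Continuous (PowerSeries.evalNegHom : ℤ⟦X⟧ →+* ℤ⟦X⟧) := by
  refine continuous_iff_continuousAt.2 fun f => ?_
  refine (PowerSeries.WithPiTopology.tendsto_iff_coeff_tendsto _ _ _ _).2 fun d => ?_
  simp only [PowerSeries.evalNegHom, PowerSeries.coeff_rescale]
  exact ((PowerSeries.WithPiTopology.continuous_coeff ℤ d).tendsto f).const_mul _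

end Convergence

/-! ### Comparison of the Euler products -/

/-- The Euler product over the prime classes of alternating cycles, in terms of the prime classes of
cycles. -/
theorem multipliable_and_tprod_altPrimeClasses {V M : Type*} [CommMonoid M] [TopologicalSpace M]
    [ContinuousMul M] [T2Space M] (G : SimpleGraph V) {F F' : ℕ → M}
    (hF : Multipliable fun c : primeClasses G => F c.1.length)
    (hF' : Multipliable fun c : primeClasses G => F' c.1.length)
    (hlcm : Multipliable fun c : primeClasses G => F (c.1.length.lcm 2))
    (heven : Multipliable fun c : {c : primeClasses G | Even c.1.length} => F c.1.1.length)
    (h : ∀ c : primeClasses G, F (c.1.length.lcm 2) *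
      (if Even c.1.length then F c.1.length else 1) = F c.1.length * F' c.1.length) :
    Multipliable (fun c : altPrimeClasses (symmDigraph G) => F c.1.length) ∧
      ∏' c : altPrimeClasses (symmDigraph G), F c.1.length =
        (∏' c : primeClasses G, F c.1.length) * ∏' c : primeClasses G, F' c.1.length := by
  obtain ⟨E, hl, hr⟩ := exists_equiv_altPrimeClasses G
  have h₁ : HasProd (fun c : primeClasses G => F (E (.inl c)).1.length)
      (∏' c : primeClasses G, F (c.1.length.lcm 2)) := by
    simpa only [hl] using hlcm.hasProd
  have h₂ : HasProd (fun c : {c : primeClasses G | Even c.1.length} => F (E (.inr c)).1.length)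
      (∏' c : {c : primeClasses G | Even c.1.length}, F c.1.1.length) := by
    simpa only [hr] using heven.hasProd
  have hsum := HasProd.sum (f := fun x => F (E x).1.length) h₁ h₂
  have h₃ : HasProd (fun c : altPrimeClasses (symmDigraph G) => F c.1.length) _ :=
    E.hasProd_iff.1 hsum
  refine ⟨h₃.multipliable, ?_⟩
  -- Extending the even-length product by `1` to all classes allows the two products to be merged
  -- factor by factor.
  have heven' : Multipliable ({c : primeClasses G | Even c.1.length}.mulIndicator
      fun c => F c.1.length) := multipliable_subtype_iff_mulIndicator.1 heven
  have hsub := tprod_subtype {c : primeClasses G | Even c.1.length} fun c => F c.1.length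
  rw [h₃.tprod_eq, hsub, ← hlcm.tprod_mul heven', ← hF.tprod_mul hF']
  refine tprod_congr fun c => ?_
  rw [← h c]
  by_cases hc : Even c.1.length
  · have hmem : c ∈ {c : primeClasses G | Even c.1.length} := hc
    rw [if_pos hc, Set.mulIndicator_of_mem hmem]
  · have hmem : c ∉ {c : primeClasses G | Even c.1.length} := hc
    rw [if_neg hc, Set.mulIndicator_of_notMem hmem]

theorem lcm_two_eq (n : ℕ) : n.lcm 2 = if Even n then n else 2 * n := by
  split_ifs with h
  · exact Nat.lcm_eq_left h.two_dvd
  · rw [Nat.Coprime.lcm_eq_mul (Nat.coprime_two_right.2 (Nat.not_even_iff_odd.1 h)), mul_comm]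

theorem length_pos_of_mem_primeClasses {V : Type*} {G : SimpleGraph V} (c : primeClasses G) :
    0 < c.1.length :=
  length_pos_of_mem_cyclicWords (primeClasses_eq.subset c.2)

theorem evalNegHom_inverse {f : ℤ⟦X⟧} (hf : IsUnit f) :
    PowerSeries.evalNegHom (Ring.inverse f) = Ring.inverse (PowerSeries.evalNegHom f) := by
  obtain ⟨u, rfl⟩ := hf
  rw [Ring.inverse_unit]
  exact (Ring.inverse_unit (Units.map (PowerSeries.evalNegHom : ℤ⟦X⟧ →+* ℤ⟦X⟧).toMonoidHom u)).symm

theorem inverse_one_sub_X_pow_lcm_two_mul {n : ℕ} :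
    (Ring.inverse (1 - PowerSeries.X ^ n.lcm 2) *
      (if Even n then Ring.inverse (1 - PowerSeries.X ^ n) else 1) : ℤ⟦X⟧) =
      Ring.inverse (1 - PowerSeries.X ^ n) * Ring.inverse (1 - (-PowerSeries.X) ^ n) := by
  rw [lcm_two_eq]
  split_ifs with h
  · rw [h.neg_pow]
  · rw [mul_one, ← Ring.mul_inverse_rev, (Nat.not_even_iff_odd.1 h).neg_pow]
    congr 1
    ring

theorem inv_one_sub_pow_lcm_two_mul (t : ℂ) (n : ℕ) :
    (1 - t ^ n.lcm 2)⁻¹ * (if Even n then (1 - t ^ n)⁻¹ else 1) =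
      (1 - t ^ n)⁻¹ * (1 - (-t) ^ n)⁻¹ := by
  rw [lcm_two_eq]
  split_ifs with h
  · rw [h.neg_pow]
  · rw [mul_one, ← mul_inv, (Nat.not_even_iff_odd.1 h).neg_pow]
    congr 1
    ring

/-- As `x ≤ 1` is not assumed, the bound is `x ^ m i + (x ^ m i) ^ 2`; the squares are summable
because `x ^ m i < 1` for all but finitely many `i`. -/
theorem summable_pow_lcm_two {ι : Type*} {x : ℝ} (hx : 0 ≤ x) {m : ι → ℕ}
    (h : Summable fun i => x ^ m i) : Summable fun i => x ^ (m i).lcm 2 := by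
  have hsq : Summable fun i => (x ^ m i) ^ 2 := by
    refine Summable.of_norm_bounded_eventually h ?_
    filter_upwards [h.tendsto_cofinite_zero.eventually (gt_mem_nhds one_pos)] with i hi
    have := pow_nonneg hx (m i)
    rw [Real.norm_of_nonneg (by positivity)]
    nlinarith
  refine (h.add hsq).of_nonneg_of_le (fun i => pow_nonneg hx _) fun i => ?_
  have := pow_nonneg hx (m i)
  rw [lcm_two_eq]
  split_ifs
  · nlinarith
  · rw [mul_comm, pow_mul]
    linarith

/-- For odd `n`, `t ^ (2 * n) = 1` means `t ^ n = 1` or `t ^ n = -1`, and the latter is `(-t) ^ n =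
1`. -/
theorem pow_lcm_two_ne_one {t : ℂ} {n : ℕ} (h : t ^ n ≠ 1) (h' : (-t) ^ n ≠ 1) :
    t ^ n.lcm 2 ≠ 1 := by
  rw [lcm_two_eq]
  split_ifs with hn
  · exact h
  · rw [(Nat.not_even_iff_odd.1 hn).neg_pow] at h'
    rw [mul_comm, pow_mul, Ne, sq_eq_one_iff]
    rintro (h₁ | h₁)
    · exact h h₁
    · exact h' (by rw [h₁, neg_neg])

end AltZeta

theorem theorem7 {V : Type*} [Finite V] (G : SimpleGraph V) (hG : G.Connected) :
    (Multipliable (fun c : AltZeta.primeClasses G => AltZeta.formalFactor c.1) ∧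
      Multipliable (fun c : AltZeta.altPrimeClasses (AltZeta.symmDigraph G) =>
        AltZeta.formalFactor c.1) ∧
      AltZeta.altZetaFormal (AltZeta.symmDigraph G) =
        AltZeta.iharaZetaFormal G * PowerSeries.evalNegHom (AltZeta.iharaZetaFormal G)) ∧
    (∃ r : ℝ, 0 < r ∧ ∀ t : ℂ, ‖t‖ < r →
      Summable (fun c : AltZeta.primeClasses G => ‖t‖ ^ c.1.length)) ∧
    (∀ t : ℂ, Summable (fun c : AltZeta.primeClasses G => ‖t‖ ^ c.1.length) →
      (∀ c : AltZeta.primeClasses G, t ^ c.1.length ≠ 1 ∧ (-t) ^ c.1.length ≠ 1) →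
      Multipliable (fun c : AltZeta.primeClasses G => AltZeta.factor t c.1) ∧
      Multipliable (fun c : AltZeta.primeClasses G => AltZeta.factor (-t) c.1) ∧
      Multipliable (fun c : AltZeta.altPrimeClasses (AltZeta.symmDigraph G) =>
        AltZeta.factor t c.1) ∧
      AltZeta.altZeta (AltZeta.symmDigraph G) t =
        AltZeta.iharaZeta G t * AltZeta.iharaZeta G (-t)) := by
  have hpos := AltZeta.length_pos_of_mem_primeClasses (G := G)
  have : Finite G.Dart := Finite.of_injective _ SimpleGraph.Dart.toProd_injective
  refine ⟨?_, AltZeta.exists_summable_pow_length _, fun t ht hne => ?_⟩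
  · have hlen := AltZeta.tendsto_length_cofinite (AltZeta.primeClasses G)
    have hF := AltZeta.multipliable_inverse_one_sub_X_pow hpos hlen
    have hneg : ∀ c : AltZeta.primeClasses G,
        PowerSeries.evalNegHom (AltZeta.formalFactor c.1) =
          Ring.inverse (1 - (-PowerSeries.X) ^ c.1.length) := fun c => by
      rw [AltZeta.formalFactor, AltZeta.evalNegHom_inverse (AltZeta.isUnit_one_sub_X_pow (hpos c))]
      simp
    have hF' : Multipliable fun c : AltZeta.primeClasses G =>
        (Ring.inverse (1 - (-PowerSeries.X) ^ c.1.length) : ℤ⟦X⟧) :=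
      (hF.map PowerSeries.evalNegHom AltZeta.continuous_evalNegHom).congr hneg
    have hlcm := AltZeta.multipliable_inverse_one_sub_X_pow
      (fun c => Nat.lcm_pos (hpos c) two_pos)
      (Filter.tendsto_atTop_mono (fun c : AltZeta.primeClasses G =>
        Nat.le_of_dvd (Nat.lcm_pos (hpos c) two_pos) (Nat.dvd_lcm_left _ 2)) hlen)
    have heven := AltZeta.multipliable_inverse_one_sub_X_pow
      (fun c : {c : AltZeta.primeClasses G | Even c.1.length} => hpos c.1)
      (hlen.comp Subtype.val_injective.tendsto_cofinite)
    obtain ⟨hm, hp⟩ := AltZeta.multipliable_and_tprod_altPrimeClasses G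
      (F := fun n => Ring.inverse (1 - PowerSeries.X ^ n : ℤ⟦X⟧))
      (F' := fun n => Ring.inverse (1 - (-PowerSeries.X) ^ n : ℤ⟦X⟧)) hF hF' hlcm heven
      fun c => AltZeta.inverse_one_sub_X_pow_lcm_two_mul
    refine ⟨hF, hm, hp.trans ?_⟩
    have hmap := hF.map_tprod PowerSeries.evalNegHom AltZeta.continuous_evalNegHom
    exact congrArg _ ((tprod_congr hneg).symm.trans hmap.symm)
  · have hF := AltZeta.multipliable_inv_one_sub (a := fun c : AltZeta.primeClasses G =>
      t ^ c.1.length) (by simpa using ht) fun c => (hne c).1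
    have hF' := AltZeta.multipliable_inv_one_sub (a := fun c : AltZeta.primeClasses G =>
      (-t) ^ c.1.length) (by simpa using ht) fun c => (hne c).2
    have hlcm := AltZeta.multipliable_inv_one_sub (a := fun c : AltZeta.primeClasses G =>
      t ^ c.1.length.lcm 2) (by simpa using AltZeta.summable_pow_lcm_two (norm_nonneg t) ht)
      fun c => AltZeta.pow_lcm_two_ne_one (hne c).1 (hne c).2
    have heven := AltZeta.multipliable_inv_one_sub
      (a := fun c : {c : AltZeta.primeClasses G | Even c.1.length} => t ^ c.1.1.length)
      (by simpa [Function.comp_def] using ht.comp_injective Subtype.val_injective) fun c => (hne c.1).1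
    obtain ⟨hm, hp⟩ := AltZeta.multipliable_and_tprod_altPrimeClasses G
      (F := fun n => (1 - t ^ n)⁻¹) (F' := fun n => (1 - (-t) ^ n)⁻¹) hF hF' hlcm heven
      fun c => AltZeta.inv_one_sub_pow_lcm_two_mul t _
    exact ⟨hF, hF', hm, hp⟩
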